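/- Conventions: all spaces are Hausdorff and $I=[0,1]$. For $S\subseteq(0,1)$, let $I_S=(I\times\{0\})\cup(S\times\{1\})$, ordered lexicographically and given the order topology (so each point of $S$ is split into two neighbours). A \emph{perfect} set is a nonempty closed set without isolated points, and a space is \emph{scattered} if it has no perfect subset. For a continuous map $f:X\to Y$ of compact spaces, a \emph{loose family} for $f$ is a pairwise disjoint family $\mathcal P$ of closed subsets of $X$ for which there is a non-scattered $Q\subseteq Y$ with $f(P)=Q$ for all $P\in\mathcal P$; $f$ is \emph{$\kappa$-tight} if it has no loose family of size $\kappa$. A continuous map $f:X\to Y$ is \emph{finer} than a continuous $g:X\to Z$ if $g=\Gamma\circ f$ for some continuous $\Gamma:f(X)\to g(X)$. $X$ is \emph{$\kappa$-dissipated} if $X$ is compact and for every continuous map $g$ from $X$ to a compact metric space there is a finer, $\kappa$-tight continuous map $f$ from $X$ to a compact metric space. For a real $r>0$, a compact space $X$ is \emph{$n$-big (with constant $r$)} if for every subalgebra $\mathcal A$ of $C(X)=C(X,\mathbb C)$ that separates points and contains the constants, and every $\Upsilon:\mathcal A\to\omega$, there are $f_1,\dots,f_n\in\mathcal A$ and a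 point $c\in X$ such that $\Upsilon(f_1)=\dots=\Upsilon(f_n)$ and $|f_i(c)-f_j(c)|\ge r$ whenever $1\le i<j\le n$. \textbf{Lemma.} Let $S\subseteq(0,1)$ and let $X$ be a closed subspace of $(I_S)^3$ that is not $3$-dissipated and does not contain a homeomorphic copy of the Cantor set. Then $X$ is $6$-big, with any constant $r>0$. -/

import Mathlib

/-- The underlying set of `I_S`: the pairs `(x, 0)` with `x ∈ [0,1]` and `(x, 1)` with
`x ∈ S ∩ [0,1]` (`false` is `0`, `true` is `1`), inside `ℝ × {0,1}` with the lexicographic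
order. -/
def SplitInterval (S : Set ℝ) : Type :=
  {p : ℝ ×ₗ Bool // (ofLex p).1 ∈ Set.Icc (0 : ℝ) 1 ∧ ((ofLex p).2 = true → (ofLex p).1 ∈ S)}

noncomputable instance SplitInterval.instLinearOrder (S : Set ℝ) :
    LinearOrder (SplitInterval S) :=
  inferInstanceAs (LinearOrder
    {p : ℝ ×ₗ Bool // (ofLex p).1 ∈ Set.Icc (0 : ℝ) 1 ∧ ((ofLex p).2 = true → (ofLex p).1 ∈ S)})

/-- `I_S` carries the order topology of its (lexicographic) order. -/
noncomputable instance SplitInterval.instTopologicalSpace (S : Set ℝ) : TopologicalSpace (SplitInterval S) :=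
  Preorder.topology (SplitInterval S)

instance SplitInterval.instOrderTopology (S : Set ℝ) : OrderTopology (SplitInterval S) :=
  ⟨rfl⟩

/-- A space is scattered iff it has no perfect subset, where perfect sets are closed, nonempty
and without isolated points (Mathlib's `Perfect` does not include nonemptiness). -/
def IsScatteredSpace (X : Type*) [TopologicalSpace X] : Prop :=
  ¬ ∃ P : Set X, P.Nonempty ∧ Perfect P

/-- `X` contains a homeomorphic copy of the Cantor set. -/
def ContainsCantorSet (X : Type*) [TopologicalSpace X] : Prop :=
  ∃ φ : (ℕ → Bool) → X, Topology.IsEmbedding φ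

/-- A loose family for `f : X → Y`: a disjoint family of closed subsets of `X`, all having the
same non-scattered image `Q` under `f`. -/
def IsLooseFamily {X Y : Type*} [TopologicalSpace X] [TopologicalSpace Y] (f : C(X, Y))
    (𝓟 : Set (Set X)) : Prop :=
  (∀ P ∈ 𝓟, IsClosed P) ∧ 𝓟.PairwiseDisjoint id ∧
    ∃ Q : Set Y, ¬ IsScatteredSpace Q ∧ ∀ P ∈ 𝓟, f '' P = Q

/-- `f` is `κ`-tight: there is no loose family for `f` of size `κ`. -/
def IsTightMap {X : Type*} {Y : Type*} [TopologicalSpace X] [TopologicalSpace Y] (κ : Cardinal)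
    (f : C(X, Y)) : Prop :=
  ¬ ∃ 𝓟 : Set (Set X), IsLooseFamily f 𝓟 ∧ Cardinal.mk 𝓟 = κ

/-- `f` is finer than `g`: `g = Γ ∘ f` for some continuous `Γ` from `f(X)` to `g(X)`. -/
def IsFinerMap {X Y Z : Type*} [TopologicalSpace X] [TopologicalSpace Y] [TopologicalSpace Z]
    (f : C(X, Y)) (g : C(X, Z)) : Prop :=
  ∃ Γ : C(Set.range f, Set.range g), ∀ x : X, (Γ ⟨f x, Set.mem_range_self x⟩ : Z) = g x

/-- `X` is `κ`-dissipated: `X` is compact, and every continuous map `g` from `X` to a compact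
metric space has a finer continuous `κ`-tight map `f` to a compact metric space. Only the image
of `X` matters here, and it is a quotient of `X`, so targets in the universe of `X` suffice. -/
def IsDissipated.{u} (κ : Cardinal.{u}) (X : Type u) [TopologicalSpace X] : Prop :=
  CompactSpace X ∧
    ∀ (Y : Type u) [TopologicalSpace Y] [CompactSpace Y] [TopologicalSpace.MetrizableSpace Y]
      (g : C(X, Y)),
      ∃ (Z : Type u) (_ : TopologicalSpace Z) (_ : CompactSpace Z)
        (_ : TopologicalSpace.MetrizableSpace Z) (f : C(X, Z)),
        IsFinerMap f g ∧ IsTightMap κ f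

/-- `X` is `n`-big (for the separation constant `r`): `X` is compact, and for every (complex,
unital, not necessarily closed or self-adjoint) subalgebra `A` of `C(X, ℂ)` that separates
points and every partition `Υ : A → ℕ`, there are `f₁, …, fₙ ∈ A` in the same piece and a point
`c` at which their values have pairwise distance at least `r`. -/
def IsBig (r : ℝ) (n : ℕ) (X : Type*) [TopologicalSpace X] : Prop :=
  CompactSpace X ∧
    ∀ A : Subalgebra ℂ C(X, ℂ), A.SeparatesPoints → ∀ Υ : A → ℕ,
      ∃ (f : Fin n → A) (c : X), (∀ i j, Υ (f i) = Υ (f j)) ∧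
        ∀ i j, i < j → r ≤ ‖(f i : C(X, ℂ)) c - (f j : C(X, ℂ)) c‖

/-!
Write a point of `I_S` as a real number `x ∈ [0, 1]` together with, for `x ∈ S`, the half of the
split point `x` in which it lies. Every continuous map from `X` to a metrizable space depends on
the halves over countably many points of `S` only (`exists_countable_collapse_factors`), so that,
as `X` is not `3`-dissipated, for arbitrarily large countable `D ⊆ S` the map `collapse` forgetting
the halves outside `D` has a loose family of three closed sets over an uncountable closed `Q`.

If points of `Q` approach `q ∈ Q` with changing `i`-th coordinate, then they do so from one side,
and this decides the `i`-th coordinate of a limit point over `q` in each of the three sets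
(`exists_mem_fiber_of_neBot`). If two coordinates were decided in this way, only two points over
`q` would remain, while the three sets are disjoint. Hence `Q` is locally contained in the union of
three lines parallel to the axes, and some such line, over a pair `(s₁, s₂)`, contains uncountably
many points of `Q`. At its accumulation points one coordinate is decided, so the three points over
them use three of the four halves over `(s₁, s₂)`; in particular `s₁, s₂ ∈ S \ D`, and both equal
and opposite halves occur. As `X` contains no Cantor set, uncountably many of the points on the line
have their remaining coordinate in `S` as well (`not_countable_inter_of_lift`).

Since `D` is arbitrary, this gives uncountably many lines, in one direction, with pairwise distinct
`s₁` and pairwise distinct `s₂` (`exists_not_countable_lines`). For each `y ∈ S³` the algebra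
contains a function that near the fiber of `y` takes widely separated values in the eight octants
at `y` (`exists_octant_approx`). Its piece and a basic neighbourhood are a countable amount of
data, so there are uncountably many lines with three points `x₁ < c < x₂` each for which all data
agree, the three points being separated by the same two rationals on all lines. Some line `a` of
these lies between two others `b`, `d`, both coordinates being monotone or one of them reversed
(`exists_between_of_injOn`). Over `c` on the line `a`, choose a point of `X` in opposite halves in
the first case, and in equal halves in the second. With respect to the points `x₁`, `x₂` on the
lines `a`, `b`, `d` it lies in six different octants, so the corresponding six functions have
separated values there.
-/

open Set Filter Topology

/-! ### The split interval -/

namespace SplitInterval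

variable {S : Set ℝ}

/-- The projection of `I_S` to the unit interval, with values in `ℝ`. -/
def proj (z : SplitInterval S) : ℝ := (ofLex z.1).1

/-- The second coordinate of a point of `I_S`: whether it is the upper half of a split point. -/
def bit (z : SplitInterval S) : Bool := (ofLex z.1).2

/-- The side of `s` on which a point of `I_S` lies. For `s ∈ S`, it is `true` if the point is at
least `(s, 1)`, and `false` if it is at most `(s, 0)`; the definition makes sense for all `s`. -/
noncomputable def side (s : ℝ) (z : SplitInterval S) : Bool :=
  decide (s < z.proj) || (decide (s = z.proj) && z.bit)

/-- The point `(x, b)` of `I_S`. -/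
def mk (x : ℝ) (b : Bool) (hx : x ∈ Icc (0 : ℝ) 1) (hb : b = true → x ∈ S) : SplitInterval S :=
  ⟨toLex (x, b), hx, hb⟩

@[simp] lemma proj_mk (x : ℝ) (b : Bool) (hx : x ∈ Icc (0 : ℝ) 1) (hb : b = true → x ∈ S) :
    (mk x b hx hb).proj = x := rfl

@[simp] lemma bit_mk (x : ℝ) (b : Bool) (hx : x ∈ Icc (0 : ℝ) 1) (hb : b = true → x ∈ S) :
    (mk x b hx hb).bit = b := rfl

lemma proj_mem (z : SplitInterval S) : z.proj ∈ Icc (0 : ℝ) 1 := z.2.1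

lemma proj_mem_of_bit {z : SplitInterval S} (h : z.bit = true) : z.proj ∈ S := z.2.2 h

lemma ext' {z w : SplitInterval S} (h : z.proj = w.proj) (hb : z.bit = w.bit) : z = w :=
  Subtype.ext (ofLex.injective (Prod.ext h hb))

lemma le_def {z w : SplitInterval S} :
    z ≤ w ↔ z.proj < w.proj ∨ z.proj = w.proj ∧ z.bit ≤ w.bit :=
  Prod.Lex.le_iff

lemma lt_def {z w : SplitInterval S} :
    z < w ↔ z.proj < w.proj ∨ z.proj = w.proj ∧ z.bit < w.bit :=
  Prod.Lex.lt_iff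

lemma side_proj (z : SplitInterval S) : side z.proj z = z.bit := by
  simp [side]

lemma side_of_eq {s : ℝ} {z : SplitInterval S} (h : z.proj = s) : side s z = z.bit := by
  simp [side, h]

lemma side_of_lt {s : ℝ} {z : SplitInterval S} (h : s < z.proj) : side s z = true := by
  simp [side, h]

lemma side_of_gt {s : ℝ} {z : SplitInterval S} (h : z.proj < s) : side s z = false := by
  simp [side, h.le, h.ne']

/-- Two points over the same `x` lie on the same side of every `s ≠ x`. -/
lemma side_eq_of_proj_eq {s : ℝ} {z w : SplitInterval S} (h : z.proj = w.proj)
    (hs : s ≠ z.proj) : side s z = side s w := by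
  simp [side, h, h ▸ hs]

lemma proj_monotone : Monotone (proj : SplitInterval S → ℝ) := fun z w h => by
  rcases le_def.1 h with h | h
  exacts [h.le, h.1.le]

lemma continuous_proj : Continuous (proj : SplitInterval S → ℝ) := by
  have h : Continuous (fun z : SplitInterval S => (⟨z.proj, z.proj_mem⟩ : Icc (0 : ℝ) 1)) :=
    Monotone.continuous_of_surjective (fun z w h => proj_monotone h)
      fun x => ⟨mk x false x.2 (by simp), rfl⟩
  exact continuous_subtype_val.comp h

lemma continuous_side (hS : S ⊆ Ioo (0 : ℝ) 1) {s : ℝ} (hs : s ∈ S) :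
    Continuous (side s : SplitInterval S → Bool) := by
  have hs' := Ioo_subset_Icc_self (hS hs)
  have h1 : side s ⁻¹' {true} = Ici (mk s true hs' fun _ => hs : SplitInterval S) := by
    ext z
    have : (true ≤ z.bit) ↔ z.bit = true := by cases z.bit <;> simp
    simp [side, le_def, this]
  have h2 : side s ⁻¹' {true} = (Iic (mk s false hs' (by simp) : SplitInterval S))ᶜ := by
    ext z
    have : (false < z.bit) ↔ z.bit = true := by cases z.bit <;> simp
    simp [side, lt_def, this]
  rw [continuous_discrete_rng]
  have h3 : IsClopen (side s ⁻¹' {true} : Set (SplitInterval S)) :=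
    ⟨h1 ▸ isClosed_Ici, h2 ▸ isClosed_Iic.isOpen_compl⟩
  rintro (_ | _)
  · convert h3.compl.isOpen using 1
    ext z
    simp
  · exact h3.isOpen

/-- An ultrafilter on `I_S` whose projection tends to `x` converges to `(x, 1)` if `x ∈ S` and the
ultrafilter lives on the right of `x`, and to `(x, 0)` otherwise. -/
instance instCompactSpace : CompactSpace (SplitInterval S) := by
  classical
  refine ⟨isCompact_iff_ultrafilter_le_nhds.2 fun F _ => ?_⟩
  obtain ⟨x, hx, hFx⟩ := isCompact_iff_ultrafilter_le_nhds.1 (isCompact_Icc (a := (0 : ℝ)) (b := 1))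
    (F.map proj) (by
      rw [le_principal_iff]
      exact Filter.univ_mem' (f := (F : Filter (SplitInterval S))) fun z => z.proj_mem)
  have hFx : Tendsto proj (F : Filter (SplitInterval S)) (𝓝 x) := hFx
  -- the side of `x` on which `F` concentrates
  obtain ⟨b, hb⟩ : ∃ b, ∀ᶠ z : SplitInterval S in F, side x z = b := by
    rcases F.em (fun z => side x z = true) with h | h
    · exact ⟨true, h⟩
    · exact ⟨false, h.mono fun z hz => by simpa using hz⟩
  by_cases hc : x ∈ S ∧ b = true
  · obtain ⟨hxS, rfl⟩ := hc
    refine ⟨mk x true hx fun _ => hxS, mem_univ _, ?_⟩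
    refine tendsto_order.2 ⟨fun w hw => ?_, fun w hw => ?_⟩
    · rcases lt_def.1 hw with hw | hw
      · filter_upwards [hFx.eventually (lt_mem_nhds hw)] with z hz
        exact lt_def.2 (Or.inl hz)
      · filter_upwards [hb] with z hz
        have h1 : w.proj = x := hw.1
        have h2 : w.bit < true := hw.2
        simp only [side, Bool.or_eq_true, decide_eq_true_eq, Bool.and_eq_true] at hz
        refine lt_def.2 ?_
        rw [h1]
        exact hz.imp id fun h : x = z.proj ∧ z.bit = true => ⟨h.1, by rw [h.2]; exact h2⟩
    · rcases lt_def.1 hw with hw | hw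
      · filter_upwards [hFx.eventually (gt_mem_nhds hw)] with z hz
        exact lt_def.2 (Or.inl hz)
      · exact absurd hw.2 (by simp)
  · refine ⟨mk x false hx (by simp), mem_univ _, ?_⟩
    refine tendsto_order.2 ⟨fun w hw => ?_, fun w hw => ?_⟩
    · rcases lt_def.1 hw with hw | hw
      · filter_upwards [hFx.eventually (lt_mem_nhds hw)] with z hz
        exact lt_def.2 (Or.inl hz)
      · exact absurd hw.2 (by simp)
    · rcases lt_def.1 hw with hw | hw
      · filter_upwards [hFx.eventually (gt_mem_nhds hw)] with z hz
        exact lt_def.2 (Or.inl hz)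
      · have h1 : x = w.proj := hw.1
        have h2 : w.bit = true := Bool.eq_true_of_not_eq_false fun h => by
          have h3 : false < w.bit := hw.2
          rw [h] at h3
          exact lt_irrefl _ h3
        have hbf : b = false := by
          simpa [h1 ▸ proj_mem_of_bit h2] using hc
        subst hbf
        filter_upwards [hb] with z hz
        refine lt_def.2 ?_
        rw [← h1, h2]
        simp only [side, Bool.or_eq_false_iff, decide_eq_false_iff_not, Bool.and_eq_false_iff,
          not_lt] at hz
        rcases hz.1.lt_or_eq with h | h
        · exact Or.inl h
        · refine Or.inr ⟨h, ?_⟩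
          rcases hz.2 with h' | h'
          · exact absurd h.symm h'
          · simp [h']

/-- The projection and the sides of the points of `S` together separate the points of `I_S`. -/
lemma eq_of_side_eq {z w : SplitInterval S} (h : z.proj = w.proj)
    (hs : ∀ s ∈ S, side s z = side s w) : z = w := by
  refine ext' h ?_
  by_cases hz : z.proj ∈ S
  · have := hs _ hz
    rwa [side_proj, h, side_proj] at this
  · have hz' : ¬ z.bit = true := fun h => hz (proj_mem_of_bit h)
    have hw' : ¬ w.bit = true := fun h' => hz (h ▸ proj_mem_of_bit h')
    rw [Bool.not_eq_true] at hz' hw'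
    rw [hz', hw']

/-- The topology of `I_S` is induced by the projection and the sides of the points of `S`. -/
lemma continuous_of_proj_of_side (hS : S ⊆ Ioo (0 : ℝ) 1) {T : Type*} [TopologicalSpace T]
    {f : T → SplitInterval S} (hp : Continuous fun t => (f t).proj)
    (hs : ∀ s ∈ S, Continuous fun t => side s (f t)) : Continuous f := by
  let e : SplitInterval S → ℝ × (S → Bool) := fun z => (z.proj, fun s => side s z)
  have he : Continuous e :=
    continuous_proj.prodMk (continuous_pi fun s => continuous_side hS s.2)
  have hinj : Function.Injective e := fun z w h =>
    eq_of_side_eq (Prod.ext_iff.1 h).1 fun s hs => congrFun (Prod.ext_iff.1 h).2 ⟨s, hs⟩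
  exact (he.isClosedEmbedding hinj).isInducing.continuous_iff.2
    (hp.prodMk (continuous_pi fun s => hs s s.2))

end SplitInterval

/-! ### Cantor sets -/

/-- A closed uncountable set of reals contains a Cantor set avoiding any given countable set. -/
lemma IsClosed.exists_cantor_injection_diff {E C : Set ℝ} (hE : IsClosed E)
    (hunc : ¬ E.Countable) (hC : C.Countable) :
    ∃ φ : (ℕ → Bool) → ℝ, Continuous φ ∧ Function.Injective φ ∧ ∀ t, φ t ∈ E \ C := by
  have hm : MeasurableSet (E \ C) := hE.measurableSet.diff hC.measurableSet
  obtain ⟨t', ht, hpol, hcl, -⟩ := hm.isClopenable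
  have hn : ¬ (E \ C).Countable := fun h =>
    hunc ((h.union hC).mono fun x hx => by
      by_cases hxC : x ∈ C
      · exact Or.inr hxC
      · exact Or.inl ⟨hx, hxC⟩)
  obtain ⟨φ, hφ, hcont, hinj⟩ :=
    @IsClosed.exists_nat_bool_injection_of_not_countable ℝ t' hpol _ hcl hn
  exact ⟨φ, continuous_le_rng ht hcont, hinj, fun t => hφ (mem_range_self t)⟩

/-- If a closed subspace of `I_S³` contains no Cantor set, then every uncountable closed set `E` of
reals that lifts to it along a line parallel to an axis, the other two coordinates lying over
`s₁, s₂ ∈ S`, has uncountably many points in `S`: a Cantor set inside `E \ S` would lift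
homeomorphically. -/
lemma not_countable_inter_of_lift {S : Set ℝ} (hS : S ⊆ Ioo (0 : ℝ) 1)
    {X : Set (Fin 3 → SplitInterval S)} (hX : IsClosed X) (hCantor : ¬ ContainsCantorSet X)
    {E : Set ℝ} (hE : IsClosed E) (hunc : ¬ E.Countable) (i : Fin 3) {s₁ s₂ : ℝ}
    (hs₁ : s₁ ∈ S) (hs₂ : s₂ ∈ S)
    (hlift : ∀ x ∈ E, ∃ p ∈ X, (p i).proj = x ∧ (p (i + 1)).proj = s₁ ∧ (p (i + 2)).proj = s₂) :
    ¬ (E ∩ S).Countable := by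
  intro hcount
  -- the part of `X` on one of the four lines over `(s₁, s₂)`
  let K : Bool × Bool → Set (Fin 3 → SplitInterval S) := fun bc =>
    {p | p ∈ X ∧ (p (i + 1)).proj = s₁ ∧ (p (i + 2)).proj = s₂ ∧
      SplitInterval.side s₁ (p (i + 1)) = bc.1 ∧ SplitInterval.side s₂ (p (i + 2)) = bc.2}
  have hK : ∀ bc, IsClosed (K bc) := fun bc => by
    have c1 : Continuous fun p : Fin 3 → SplitInterval S => (p (i + 1)).proj :=
      SplitInterval.continuous_proj.comp (continuous_apply _)
    have c2 : Continuous fun p : Fin 3 → SplitInterval S => (p (i + 2)).proj :=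
      SplitInterval.continuous_proj.comp (continuous_apply _)
    have c3 : Continuous fun p : Fin 3 → SplitInterval S =>
        SplitInterval.side s₁ (p (i + 1)) :=
      (SplitInterval.continuous_side hS hs₁).comp (continuous_apply _)
    have c4 : Continuous fun p : Fin 3 → SplitInterval S =>
        SplitInterval.side s₂ (p (i + 2)) :=
      (SplitInterval.continuous_side hS hs₂).comp (continuous_apply _)
    exact hX.inter ((isClosed_eq c1 continuous_const).inter ((isClosed_eq c2 continuous_const).inter
      ((isClosed_eq c3 continuous_const).inter (isClosed_eq c4 continuous_const))))
  let G : Bool × Bool → Set ℝ := fun bc => E ∩ (fun p => (p i).proj) '' K bc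
  have hG : ∀ bc, IsClosed (G bc) := fun bc =>
    hE.inter ((hK bc).isCompact.image
      (SplitInterval.continuous_proj.comp (continuous_apply i))).isClosed
  obtain ⟨bc, hbc⟩ : ∃ bc, ¬ (G bc).Countable := by
    by_contra! h
    refine hunc ((countable_iUnion h).mono fun x hx => ?_)
    obtain ⟨p, hp, h0, h1, h2⟩ := hlift x hx
    exact mem_iUnion.2 ⟨(SplitInterval.side s₁ (p (i + 1)), SplitInterval.side s₂ (p (i + 2))),
      hx, p, ⟨hp, h1, h2, rfl, rfl⟩, h0⟩
  obtain ⟨φ, hφc, hφi, hφ⟩ := (hG bc).exists_cantor_injection_diff hbc hcount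
  choose p hpK hp using fun t => (hφ t).1.2
  have hφS : ∀ t, φ t ∉ S := fun t h => (hφ t).2 ⟨(hφ t).1.1, h⟩
  have hcont : Continuous p := by
    have hconst : ∀ (k : Fin 3) (s : ℝ) (b : Bool), (∀ t, (p t k).proj = s) →
        (∀ t, SplitInterval.side s (p t k) = b) → Continuous fun t => p t k := by
      intro k s b h1 h2
      have : ∀ t, p t k = p (fun _ => false) k := fun t =>
        SplitInterval.ext' ((h1 _).trans (h1 _).symm) (by
          rw [← SplitInterval.side_of_eq (h1 t), ← SplitInterval.side_of_eq (h1 fun _ => false),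
            h2, h2])
      exact (continuous_const (y := p (fun _ => false) k)).congr fun t => (this t).symm
    have h1 := hconst (i + 1) s₁ bc.1 (fun t => (hpK t).2.1) fun t => (hpK t).2.2.2.1
    have h2 := hconst (i + 2) s₂ bc.2 (fun t => (hpK t).2.2.1) fun t => (hpK t).2.2.2.2
    have h0 : Continuous fun t => p t i := by
      refine SplitInterval.continuous_of_proj_of_side hS (hφc.congr fun t => (hp t).symm)
        fun s hs => ?_
      -- `φ` avoids `s`, so the side of `s` is locally constant
      have hne : ∀ t, φ t ≠ s := fun t h => hφS t (h ▸ hs)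
      have hside : ∀ t, SplitInterval.side s (p t i) = true ↔ s < φ t := fun t => by
        rcases (hne t).lt_or_gt with h | h
        · rw [SplitInterval.side_of_gt ((hp t).trans_lt h)]
          simp [h.le]
        · rw [SplitInterval.side_of_lt (h.trans_eq (hp t).symm)]
          simp [h]
      rw [continuous_discrete_rng]
      rintro (_ | _)
      · convert (isOpen_Iio (a := s)).preimage hφc using 1
        ext t
        have := hside t
        rw [mem_preimage, mem_preimage, mem_singleton_iff, ← Bool.not_eq_true, this, mem_Iio,
          not_lt]
        exact (hne t).le_iff_lt
      · convert (isOpen_Ioi (a := s)).preimage hφc using 1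
        ext t
        exact hside t
    refine continuous_pi fun k => ?_
    obtain rfl | rfl | rfl : k = i ∨ k = i + 1 ∨ k = i + 2 := by omega
    exacts [h0, h1, h2]
  have hcont' : Continuous fun t => (⟨p t, (hpK t).1⟩ : X) := hcont.subtype_mk _
  refine hCantor ⟨_, (hcont'.isClosedEmbedding fun t t' h => hφi ?_).isEmbedding⟩
  rw [← hp t, ← hp t']
  exact congrArg (fun q : X => (q.1 i).proj) h

/-! ### Metrizable quotients -/

open SplitInterval in
/-- The map from a subspace of `I_S³` that forgets the splitting of all points outside `D`: each
coordinate is sent to its projection and its sides of the points of `D`. -/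
noncomputable def collapse {S : Set ℝ} (hS : S ⊆ Ioo (0 : ℝ) 1)
    (X : Set (Fin 3 → SplitInterval S)) {D : Set ℝ} (hD : D ⊆ S) :
    C(X, Fin 3 → Icc (0 : ℝ) 1 × (D → Bool)) where
  toFun p i := (⟨(p.1 i).proj, (p.1 i).proj_mem⟩, fun d => side d (p.1 i))
  continuous_toFun := by
    refine continuous_pi fun i => Continuous.prodMk ?_ (continuous_pi fun d => ?_)
    · exact (continuous_proj.comp ((continuous_apply i).comp continuous_subtype_val)).subtype_mk _
    · exact (continuous_side hS (hD d.2)).comp ((continuous_apply i).comp continuous_subtype_val)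

section collapse

variable {S : Set ℝ} {hS : S ⊆ Ioo (0 : ℝ) 1} {X : Set (Fin 3 → SplitInterval S)}
  {D : Set ℝ} {hD : D ⊆ S}

lemma collapse_apply_eq_iff {p q : X} {i : Fin 3} :
    collapse hS X hD p i = collapse hS X hD q i ↔
      (p.1 i).proj = (q.1 i).proj ∧ ∀ d ∈ D, (p.1 i).side d = (q.1 i).side d := by
  simp [collapse, Prod.ext_iff, funext_iff, Subtype.ext_iff]

lemma collapse_apply_fst (p : X) (i : Fin 3) :
    ((collapse hS X hD p i).1 : ℝ) = (p.1 i).proj := rfl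

end collapse

/-- Every continuous map from a closed subspace of `I_S³` to a metrizable space depends on the
splitting of only countably many points. -/
lemma exists_countable_collapse_factors {S : Set ℝ} (hS : S ⊆ Ioo (0 : ℝ) 1)
    {X : Set (Fin 3 → SplitInterval S)} (hX : IsClosed X) {Y : Type*} [TopologicalSpace Y]
    [TopologicalSpace.MetrizableSpace Y] (g : C(X, Y)) :
    ∃ D₀ : Set ℝ, D₀.Countable ∧ D₀ ⊆ S ∧ ∀ (D : Set ℝ) (hD : D ⊆ S), D₀ ⊆ D →
      ∀ p q, collapse hS X hD p = collapse hS X hD q → g p = g q := by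
  have : CompactSpace X := isCompact_iff_compactSpace.1 hX.isCompact
  let := TopologicalSpace.metrizableSpaceMetric Y
  -- the pairs separated by `g` form a σ-compact set
  let W : ℕ → Set (X × X) := fun n => {pq | 1 / ((n : ℝ) + 1) ≤ dist (g pq.1) (g pq.2)}
  have hW : IsLindelof (⋃ n, W n) := isLindelof_iUnion fun n =>
    (isClosed_le continuous_const (by fun_prop)).isCompact.isLindelof
  -- it is covered by the open sets of pairs separated by a projection or by a side of `s ∈ S`
  let U : Option S → Set (X × X) := fun o => o.elim
    (⋃ i, {pq | (pq.1.1 i).proj ≠ (pq.2.1 i).proj})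
    fun s => ⋃ i, {pq | (pq.1.1 i).side s ≠ (pq.2.1 i).side s}
  have h1 : ∀ i, Continuous fun pq : X × X => pq.1.1 i := fun i =>
    (continuous_apply i).comp (continuous_subtype_val.comp continuous_fst)
  have h2 : ∀ i, Continuous fun pq : X × X => pq.2.1 i := fun i =>
    (continuous_apply i).comp (continuous_subtype_val.comp continuous_snd)
  have hU : ∀ o, IsOpen (U o) := by
    rintro (_ | s)
    · exact isOpen_iUnion fun i => isOpen_ne_fun (SplitInterval.continuous_proj.comp (h1 i))
        (SplitInterval.continuous_proj.comp (h2 i))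
    · exact isOpen_iUnion fun i => isOpen_ne_fun
        ((SplitInterval.continuous_side hS s.2).comp (h1 i))
        ((SplitInterval.continuous_side hS s.2).comp (h2 i))
  have hWU : (⋃ n, W n) ⊆ ⋃ o, U o := by
    intro pq hpq
    obtain ⟨n, hn⟩ := mem_iUnion.1 hpq
    have hne : pq.1 ≠ pq.2 := fun h => by
      have hn : 1 / ((n : ℝ) + 1) ≤ dist (g pq.1) (g pq.2) := hn
      rw [h, dist_self] at hn
      exact absurd hn (not_le.2 (by positivity))
    by_contra hcon
    refine hne (Subtype.ext (funext fun i => ?_))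
    refine SplitInterval.eq_of_side_eq ?_ fun s hs => ?_
    · by_contra h
      exact hcon (mem_iUnion.2 ⟨none, mem_iUnion.2 ⟨i, h⟩⟩)
    · by_contra h
      exact hcon (mem_iUnion.2 ⟨some ⟨s, hs⟩, mem_iUnion.2 ⟨i, h⟩⟩)
  obtain ⟨r, hr, hWr⟩ := hW.elim_countable_subcover U hU hWU
  refine ⟨{s | ∃ h : s ∈ S, some ⟨s, h⟩ ∈ r}, ?_, fun s hs => hs.1, fun D hD hDr p q hpq => ?_⟩
  · refine ((hr.preimage (Option.some_injective S)).image Subtype.val).mono ?_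
    rintro s ⟨h, hs⟩
    exact ⟨⟨s, h⟩, hs, rfl⟩
  · by_contra hne
    obtain ⟨n, hn⟩ := exists_nat_one_div_lt (dist_pos.2 hne)
    have hpq' : (p, q) ∈ W n := le_of_lt hn
    obtain ⟨o, ho, hpU⟩ := mem_iUnion₂.1 (hWr (mem_iUnion.2 ⟨n, hpq'⟩))
    have hcoord := fun i => collapse_apply_eq_iff.1 (congrFun hpq i)
    rcases o with _ | s
    · obtain ⟨i, hi⟩ := mem_iUnion.1 hpU
      exact hi (hcoord i).1
    · obtain ⟨i, hi⟩ := mem_iUnion.1 hpU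
      exact hi ((hcoord i).2 s (hDr ⟨s.2, ho⟩))

lemma isFinerMap_of_factors {X Y Z : Type*} [TopologicalSpace X] [CompactSpace X]
    [TopologicalSpace Y] [T2Space Y] [TopologicalSpace Z] (f : C(X, Y)) (g : C(X, Z))
    (h : ∀ p q, f p = f q → g p = g q) : IsFinerMap f g := by
  let f' : C(X, range f) := ⟨rangeFactorization f, f.continuous.rangeFactorization⟩
  let g' : C(X, range g) := ⟨rangeFactorization g, g.continuous.rangeFactorization⟩
  have hq : IsQuotientMap f' :=
    f'.continuous.isClosedMap.isQuotientMap f'.continuous rangeFactorization_surjective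
  have hfac : Function.FactorsThrough g' f' := fun p q hpq =>
    Subtype.ext (h p q (congrArg Subtype.val hpq))
  refine ⟨hq.lift g' hfac, fun x => ?_⟩
  exact congrArg Subtype.val (DFunLike.congr_fun (hq.lift_comp g' hfac) x)

/-- If a closed subspace of `I_S³` is not `κ`-dissipated, then every countable subset of `S` can be
enlarged to a countable `D ⊆ S` for which forgetting the splitting outside `D` is not a
`κ`-tight map. -/
lemma exists_not_isTightMap_collapse {S : Set ℝ} (hS : S ⊆ Ioo (0 : ℝ) 1)
    {X : Set (Fin 3 → SplitInterval S)} (hX : IsClosed X) {κ : Cardinal}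
    (hdis : ¬ IsDissipated κ X) {D₁ : Set ℝ} (hD₁ : D₁.Countable) (hD₁S : D₁ ⊆ S) :
    ∃ (D : Set ℝ) (hD : D ⊆ S), D.Countable ∧ D₁ ⊆ D ∧ ¬ IsTightMap κ (collapse hS X hD) := by
  have : CompactSpace X := isCompact_iff_compactSpace.1 hX.isCompact
  by_contra! hcon
  refine hdis ⟨this, fun Y _ _ _ g => ?_⟩
  obtain ⟨D₀, hD₀, hD₀S, hfac⟩ := exists_countable_collapse_factors hS hX g
  have hD : D₀ ∪ D₁ ⊆ S := union_subset hD₀S hD₁S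
  have hDc : (D₀ ∪ D₁).Countable := hD₀.union hD₁
  have : Countable ↑(D₀ ∪ D₁) := hDc.to_subtype
  exact ⟨_, inferInstance, inferInstance, inferInstance, collapse hS X hD,
    isFinerMap_of_factors _ _ (hfac _ hD subset_union_left), hcon _ hD hDc subset_union_right⟩

/-! ### Loose families of three sets -/

/-- If the points of `Q` near `q`, along a filter `F`, differ from `q` in the coordinate `i`, then
all sets `P j` that are mapped onto `Q` contain a point over `q` with the same `i`-th coordinate.
Indeed `F` approaches `q i` from one side, and this decides which half of a split point is the
limit. -/
lemma exists_mem_fiber_of_neBot {S : Set ℝ} {hS : S ⊆ Ioo (0 : ℝ) 1}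
    {X : Set (Fin 3 → SplitInterval S)} [CompactSpace X] {D : Set ℝ} {hD : D ⊆ S} {ι : Type*}
    {P : ι → Set X} (hP : ∀ j, IsClosed (P j))
    {Q : Set (Fin 3 → Icc (0 : ℝ) 1 × (D → Bool))} (hPQ : ∀ j, collapse hS X hD '' P j = Q)
    {q : Fin 3 → Icc (0 : ℝ) 1 × (D → Bool)} (F : Filter (Fin 3 → Icc (0 : ℝ) 1 × (D → Bool)))
    [F.NeBot] (hFq : F ≤ 𝓝 q) (hFQ : Q ∈ F) :
    ∃ p : ι → X, (∀ j, p j ∈ P j ∧ collapse hS X hD (p j) = q) ∧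
      ∀ i, (∀ᶠ q' in F, q' i ≠ q i) → ∀ j j', (p j).1 i = (p j').1 i := by
  set f := collapse hS X hD with hf
  let U := Ultrafilter.of F
  have hUF : (U : Filter _) ≤ F := Ultrafilter.of_le F
  have hex : ∀ j, ∃ W : Ultrafilter X, Tendsto f W U ∧ P j ∈ W := fun j => by
    have : (comap f (U : Filter _) ⊓ 𝓟 (P j)).NeBot := by
      rw [inf_principal_neBot_iff]
      rintro s ⟨t, ht, hts⟩
      obtain ⟨q', hq't, hq'Q⟩ := U.nonempty_of_mem (inter_mem ht (hUF hFQ))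
      rw [← hPQ j] at hq'Q
      obtain ⟨w, hw, rfl⟩ := hq'Q
      exact ⟨w, hts hq't, hw⟩
    refine ⟨Ultrafilter.of (comap f (U : Filter _) ⊓ 𝓟 (P j)), ?_, ?_⟩
    · exact tendsto_comap.mono_left ((Ultrafilter.of_le _).trans inf_le_left)
    · exact le_principal_iff.1 ((Ultrafilter.of_le _).trans inf_le_right)
  choose W hWU hWP using hex
  have hlim : ∀ j, ∃ p ∈ P j, (W j : Filter X) ≤ 𝓝 p := fun j =>
    isCompact_iff_ultrafilter_le_nhds.1 (hP j).isCompact (W j) (le_principal_iff.2 (hWP j))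
  choose p hpP hWp using hlim
  have hfp : ∀ j, f (p j) = q := fun j =>
    tendsto_nhds_unique ((f.continuous.tendsto (p j)).mono_left (hWp j))
      ((hWU j).mono_right (hUF.trans hFq))
  refine ⟨p, fun j => ⟨hpP j, hfp j⟩, fun i hi j j' => ?_⟩
  by_contra hne
  obtain ⟨hx, hside⟩ := collapse_apply_eq_iff.1 (congrFun ((hfp j).trans (hfp j').symm) i)
  set x := ((p j).1 i).proj with hxdef
  have hbit : ((p j).1 i).side x ≠ ((p j').1 i).side x := fun h =>
    hne (SplitInterval.ext' hx (by
      rw [← SplitInterval.side_proj, ← SplitInterval.side_proj, ← hx]; exact h))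
  have hxS : x ∈ S := by
    by_contra h
    refine hne (SplitInterval.eq_of_side_eq hx fun s hs => SplitInterval.side_eq_of_proj_eq hx ?_)
    rintro rfl
    exact h hs
  have hxD : x ∉ D := fun h => hbit (hside x h)
  -- along `U`, some point over `q'` lies on the same side of `x` as `p k`
  have key : ∀ k, ∀ᶠ q' in U, ∃ w : X, f w = q' ∧ (w.1 i).side x = ((p k).1 i).side x := by
    intro k
    have hc : Continuous fun w : X => (w.1 i).side x :=
      (SplitInterval.continuous_side hS hxS).comp
        ((continuous_apply i).comp continuous_subtype_val)
    have h1 : ∀ᶠ w : X in W k, (w.1 i).side x = ((p k).1 i).side x :=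
      hWp k (hc.continuousAt.eventually (IsOpen.mem_nhds (isOpen_discrete {_}) rfl))
    have h2 : (W k).map f = U := Ultrafilter.eq_of_le (hWU k)
    rw [← h2]
    exact Ultrafilter.mem_map.2 (h1.mono fun w hw => ⟨w, rfl, hw⟩)
  obtain ⟨q', ⟨hq', w, rfl, hw⟩, w', hw', hww'⟩ :=
    (((hi.filter_mono hUF).and (key j)).and (key j')).exists
  refine hq' ?_
  obtain ⟨hpr, -⟩ := collapse_apply_eq_iff.1 (congrFun hw' i)
  have hwx : (w.1 i).proj = x := by
    by_contra h
    refine hbit ?_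
    rw [← hw, ← hww', SplitInterval.side_eq_of_proj_eq hpr.symm (Ne.symm h)]
  rw [← hfp j]
  refine collapse_apply_eq_iff.2 ⟨hwx, fun d hd => SplitInterval.side_eq_of_proj_eq hwx ?_⟩
  rintro rfl
  exact hxD (hwx ▸ hd)

lemma ext_of_collapse_eq {S : Set ℝ} {hS : S ⊆ Ioo (0 : ℝ) 1}
    {X : Set (Fin 3 → SplitInterval S)} {D : Set ℝ} {hD : D ⊆ S} {p p' : X}
    (h : collapse hS X hD p = collapse hS X hD p')
    (hb : ∀ i, (p.1 i).bit = (p'.1 i).bit) : p = p' :=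
  Subtype.ext (funext fun i => SplitInterval.ext' (collapse_apply_eq_iff.1 (congrFun h i)).1 (hb i))

/-- If three disjoint sets are mapped onto `Q`, then near a point `q` of `Q` the other points of
`Q` differ from `q` in one coordinate only: otherwise two coordinates of the three points over `q`
are decided, which leaves room for only two points. -/
lemma eventually_eq_or_eq_of_disjoint {S : Set ℝ} {hS : S ⊆ Ioo (0 : ℝ) 1}
    {X : Set (Fin 3 → SplitInterval S)} [CompactSpace X] {D : Set ℝ} {hD : D ⊆ S}
    {P : Fin 3 → Set X} (hP : ∀ j, IsClosed (P j)) (hdisj : Pairwise (Function.onFun Disjoint P))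
    {Q : Set (Fin 3 → Icc (0 : ℝ) 1 × (D → Bool))} (hPQ : ∀ j, collapse hS X hD '' P j = Q)
    (q : Fin 3 → Icc (0 : ℝ) 1 × (D → Bool)) {i i' : Fin 3} (hi : i ≠ i') :
    ∀ᶠ q' in 𝓝[Q] q, q' i = q i ∨ q' i' = q i' := by
  by_contra hcon
  have hfr : ∃ᶠ q' in 𝓝[Q] q, ¬ (q' i = q i ∨ q' i' = q i') := not_eventually.1 hcon
  have hne : (𝓝[Q] q ⊓ 𝓟 {q' | ¬ (q' i = q i ∨ q' i' = q i')}).NeBot :=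
    frequently_mem_iff_neBot.1 hfr
  obtain ⟨p, hp, hpi⟩ := exists_mem_fiber_of_neBot hP hPQ (q := q)
    (𝓝[Q] q ⊓ 𝓟 {q' | ¬ (q' i = q i ∨ q' i' = q i')}) (inf_le_left.trans nhdsWithin_le_nhds)
    (mem_inf_of_left self_mem_nhdsWithin)
  have hmem : ∀ᶠ q' in 𝓝[Q] q ⊓ 𝓟 {q' | ¬ (q' i = q i ∨ q' i' = q i')},
      ¬ (q' i = q i ∨ q' i' = q i') := mem_inf_of_right (mem_principal_self _)
  have h1 := hpi i (hmem.mono fun q' h h' => h (Or.inl h'))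
  have h2 := hpi i' (hmem.mono fun q' h h' => h (Or.inr h'))
  obtain ⟨k, hk⟩ : ∃ k : Fin 3, ∀ l, l = i ∨ l = i' ∨ l = k := by
    have : ∀ a b : Fin 3, a ≠ b → ∃ k : Fin 3, ∀ l, l = a ∨ l = b ∨ l = k := by decide
    exact this i i' hi
  obtain ⟨j, j', hjj', hb⟩ : ∃ j j', j ≠ j' ∧ ((p j).1 k).bit = ((p j').1 k).bit := by
    have : ∀ b : Fin 3 → Bool, ∃ j j', j ≠ j' ∧ b j = b j' := by decide
    exact this fun j => ((p j).1 k).bit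
  have heq : p j = p j' := ext_of_collapse_eq ((hp j).2.trans (hp j').2.symm) fun l => by
    rcases hk l with rfl | rfl | rfl
    · rw [h1 j j']
    · rw [h2 j j']
    · exact hb
  exact (hdisj hjj').le_bot ⟨(hp j).1, heq ▸ (hp j').1⟩

lemma not_countable_of_not_isScatteredSpace {Z : Type*} [TopologicalSpace Z] [CompactSpace Z]
    [TopologicalSpace.MetrizableSpace Z] {Q : Set Z} (hQ : IsClosed Q)
    (h : ¬ IsScatteredSpace Q) : ¬ Q.Countable := by
  have : CompactSpace Q := isCompact_iff_compactSpace.1 hQ.isCompact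
  let := TopologicalSpace.metrizableSpaceMetric Q
  obtain ⟨K, hKne, hK⟩ := not_not.1 h
  obtain ⟨φ, -, -, hφ⟩ := hK.exists_nat_bool_injection hKne
  intro hc
  have : Countable Q := hc.to_subtype
  have : Countable (ℕ → Bool) := hφ.countable
  have h1 : Countable (Set ℕ) := by
    classical
    exact Function.Injective.countable (f := fun (s : Set ℕ) (n : ℕ) => decide (n ∈ s))
      fun s t h => by
        ext n
        simpa using congrFun h n
  obtain ⟨g, hg⟩ := exists_injective_nat (Set ℕ)
  exact Function.cantor_injective g hg

/-- If near each point of an uncountable subset of `Z³` the other points of the set differ from it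
in one coordinate only, then uncountably many of its points lie on a line parallel to an axis. -/
lemma exists_line_not_countable {Z : Type*} [TopologicalSpace Z] [SecondCountableTopology Z]
    {Q : Set (Fin 3 → Z)} (hunc : ¬ Q.Countable)
    (h : ∀ q ∈ Q, ∀ i i' : Fin 3, i ≠ i' → ∀ᶠ q' in 𝓝[Q] q, q' i = q i ∨ q' i' = q i') :
    ∃ (i : Fin 3) (q : Fin 3 → Z), ¬ {q' ∈ Q | ∀ l, l ≠ i → q' l = q l}.Countable := by
  by_contra! hcon
  obtain ⟨t, -, ht, hQt⟩ := TopologicalSpace.countable_cover_nhdsWithin (s := Q)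
    (f := fun q => {q' | ∀ i i' : Fin 3, i ≠ i' → q' i = q i ∨ q' i' = q i'}) fun q hq => by
      have : ∀ᶠ q' in 𝓝[Q] q, ∀ i i' : Fin 3, i ≠ i' → q' i = q i ∨ q' i' = q i' := by
        simp only [eventually_all]
        exact h q hq
      exact this
  refine hunc ((ht.biUnion fun q _ => countable_iUnion fun i => hcon i q).mono fun q' hq' => ?_)
  obtain ⟨q, hqt, hq⟩ := mem_iUnion₂.1 (hQt hq')
  refine mem_iUnion₂.2 ⟨q, hqt, mem_iUnion.2 ?_⟩
  have hq : ∀ i i' : Fin 3, i ≠ i' → q' i = q i ∨ q' i' = q i' := hq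
  by_cases hall : ∀ l, q' l = q l
  · exact ⟨0, hq', fun l _ => hall l⟩
  · push Not at hall
    obtain ⟨i, hi⟩ := hall
    exact ⟨i, hq', fun l hl => (hq i l hl.symm).resolve_left hi⟩

/-- The points `x` of `S` such that, over the point with `i`-th coordinate `x` and next coordinates
(in cyclic order) `s₁` and `s₂`, the set `X` contains both a point whose last two coordinates lie
in equal halves of their fibers and a point for which they lie in opposite halves. -/
def fullFibers {S : Set ℝ} (X : Set (Fin 3 → SplitInterval S)) (i : Fin 3) (s₁ s₂ : ℝ) : Set ℝ :=
  {x | x ∈ S ∧ ∀ e : Bool, ∃ p ∈ X, (p i).proj = x ∧ (p (i + 1)).proj = s₁ ∧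
    (p (i + 2)).proj = s₂ ∧ xor (p (i + 1)).bit (p (i + 2)).bit = e}

lemma bool_pairs_of_pairwise_ne : ∀ b c : Fin 3 → Bool,
    (∀ j j', j ≠ j' → b j = b j' → c j ≠ c j') →
    (∃ j j', b j ≠ b j') ∧ (∃ j j', c j ≠ c j') ∧ ∀ e, ∃ j, xor (b j) (c j) = e := by
  decide

/-- A loose family of size `3` for the collapsing map produces uncountably many full fibers on a
line over split points outside `D`. -/
lemma exists_fullFibers_not_countable {S : Set ℝ} {hS : S ⊆ Ioo (0 : ℝ) 1}
    {X : Set (Fin 3 → SplitInterval S)} (hX : IsClosed X) (hCantor : ¬ ContainsCantorSet X)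
    {D : Set ℝ} {hD : D ⊆ S} (hDc : D.Countable) (ht : ¬ IsTightMap 3 (collapse hS X hD)) :
    ∃ i : Fin 3, ∃ s₁ ∈ S \ D, ∃ s₂ ∈ S \ D, ¬ (fullFibers X i s₁ s₂).Countable := by
  have : CompactSpace X := isCompact_iff_compactSpace.1 hX.isCompact
  have : Countable D := hDc.to_subtype
  obtain ⟨𝒞, ⟨hcl, hdisj, Q, hQ, himg⟩, hcard⟩ := not_not.1 ht
  obtain ⟨e⟩ : Nonempty (Fin 3 ≃ 𝒞) := by
    rw [← Cardinal.eq, hcard]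
    simp
  let P : Fin 3 → Set X := fun j => (e j : Set X)
  have hP : ∀ j, IsClosed (P j) := fun j => hcl _ (e j).2
  have hPd : Pairwise (Function.onFun Disjoint P) := fun j j' h =>
    hdisj (e j).2 (e j').2 fun h' => h (e.injective (Subtype.ext h'))
  have hPQ : ∀ j, collapse hS X hD '' P j = Q := fun j => himg _ (e j).2
  have hQcl : IsClosed Q := by
    rw [← hPQ 0]
    exact ((hP 0).isCompact.image (collapse hS X hD).continuous).isClosed
  have hQunc := not_countable_of_not_isScatteredSpace hQcl hQ
  obtain ⟨i, q₀, hL⟩ := exists_line_not_countable hQunc fun q _ k k' hk =>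
    eventually_eq_or_eq_of_disjoint hP hPd hPQ q hk
  have hLcl : IsClosed {q' ∈ Q | ∀ l, l ≠ i → q' l = q₀ l} := by
    have : {q' : Fin 3 → Icc (0 : ℝ) 1 × (D → Bool) | ∀ l, l ≠ i → q' l = q₀ l} =
        ⋂ (l) (_ : l ≠ i), {q' | q' l = q₀ l} := by
      ext
      simp
    have hcl : IsClosed {q' : Fin 3 → Icc (0 : ℝ) 1 × (D → Bool) | ∀ l, l ≠ i → q' l = q₀ l} := by
      rw [this]
      exact isClosed_iInter fun l => isClosed_iInter fun _ =>
        isClosed_eq (continuous_apply l) continuous_const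
    exact hQcl.inter hcl
  obtain ⟨V, K, hV, hK, hLVK⟩ := exists_countable_union_perfect_of_isClosed hLcl
  have hKunc : ¬ K.Countable := fun h => hL (hLVK ▸ hV.union h)
  have hKL : ∀ q ∈ K, q ∈ Q ∧ ∀ l, l ≠ i → q l = q₀ l := fun q hq => by
    have : q ∈ {q' ∈ Q | ∀ l, l ≠ i → q' l = q₀ l} := hLVK ▸ Or.inr hq
    exact this
  have hi1 : i + 1 ≠ i := by omega
  have hi2 : i + 2 ≠ i := by omega
  let s₁ : ℝ := (q₀ (i + 1)).1
  let s₂ : ℝ := (q₀ (i + 2)).1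
  -- over each point of `K` lie three points of `X` with the same `i`-th coordinate
  have hfib : ∀ q ∈ K, ∃ p : Fin 3 → X, (∀ j, ((p j).1 i).proj = (q i).1 ∧
      ((p j).1 (i + 1)).proj = s₁ ∧ ((p j).1 (i + 2)).proj = s₂) ∧
      (∀ j j', collapse hS X hD (p j) = collapse hS X hD (p j')) ∧
      ∀ j j', j ≠ j' → ((p j).1 (i + 1)).bit = ((p j').1 (i + 1)).bit →
        ((p j).1 (i + 2)).bit ≠ ((p j').1 (i + 2)).bit := by
    intro q hq
    have hacc : (𝓝[≠] q ⊓ 𝓟 K).NeBot := hK.acc q hq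
    obtain ⟨p, hp, hpi⟩ := exists_mem_fiber_of_neBot hP hPQ (q := q) (𝓝[≠] q ⊓ 𝓟 K)
      (inf_le_left.trans nhdsWithin_le_nhds)
      (mem_inf_of_right (mem_principal.2 fun q' hq' => (hKL q' hq').1))
    have hne : ∀ᶠ q' in 𝓝[≠] q ⊓ 𝓟 K, q' i ≠ q i := by
      have h1 : ∀ᶠ q' in 𝓝[≠] q ⊓ 𝓟 K, q' ≠ q := mem_inf_of_left self_mem_nhdsWithin
      have h2 : ∀ᶠ q' in 𝓝[≠] q ⊓ 𝓟 K, q' ∈ K := mem_inf_of_right (mem_principal_self _)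
      filter_upwards [h1, h2] with q' h1 h2 h
      refine h1 (funext fun l => ?_)
      by_cases hl : l = i
      · rw [hl, h]
      · rw [(hKL q' h2).2 l hl, (hKL q hq).2 l hl]
    have hpi := hpi i hne
    refine ⟨p, fun j => ⟨?_, ?_, ?_⟩, fun j j' => (hp j).2.trans (hp j').2.symm,
      fun j j' hjj' h1 h2 => ?_⟩
    · rw [← collapse_apply_fst (hS := hS) (hD := hD), (hp j).2]
    · rw [← collapse_apply_fst (hS := hS) (hD := hD), (hp j).2, (hKL q hq).2 _ hi1]
    · rw [← collapse_apply_fst (hS := hS) (hD := hD), (hp j).2, (hKL q hq).2 _ hi2]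
    · have heq : p j = p j' := ext_of_collapse_eq ((hp j).2.trans (hp j').2.symm) fun l => by
        obtain rfl | rfl | rfl : l = i ∨ l = i + 1 ∨ l = i + 2 := by omega
        exacts [by rw [hpi j j'], h1, h2]
      exact (hPd hjj').le_bot ⟨(hp j).1, heq ▸ (hp j').1⟩
  -- a coordinate over which two of these points differ lies over a split point outside `D`
  have hsplit : ∀ {p p' : X} {l : Fin 3}, collapse hS X hD p = collapse hS X hD p' →
      (p.1 l).bit ≠ (p'.1 l).bit → (p.1 l).proj ∈ S \ D := by
    intro p p' l h hb
    obtain ⟨h1, h2⟩ := collapse_apply_eq_iff.1 (congrFun h l)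
    refine ⟨?_, fun hd => hb ?_⟩
    · by_contra hn
      have e1 : ¬ (p.1 l).bit = true := fun h => hn (SplitInterval.proj_mem_of_bit h)
      have e2 : ¬ (p'.1 l).bit = true := fun h => hn (h1 ▸ SplitInterval.proj_mem_of_bit h)
      rw [Bool.not_eq_true] at e1 e2
      exact hb (e1.trans e2.symm)
    · have := h2 _ hd
      rwa [SplitInterval.side_proj, SplitInterval.side_of_eq h1.symm] at this
  obtain ⟨q₁, hq₁⟩ : K.Nonempty := nonempty_iff_ne_empty.2 fun h => hKunc (h ▸ countable_empty)
  have hs : s₁ ∈ S \ D ∧ s₂ ∈ S \ D := by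
    obtain ⟨p, hp, hpc, hpb⟩ := hfib q₁ hq₁
    obtain ⟨⟨j, j', hj⟩, ⟨k, k', hk⟩, -⟩ := bool_pairs_of_pairwise_ne _ _ hpb
    exact ⟨(hp j).2.1 ▸ hsplit (hpc j j') hj, (hp k).2.2 ▸ hsplit (hpc k k') hk⟩
  refine ⟨i, s₁, hs.1, s₂, hs.2, ?_⟩
  let E : Set ℝ := (fun q : Fin 3 → Icc (0 : ℝ) 1 × (D → Bool) => ((q i).1 : ℝ)) '' K
  have hE : IsClosed E := (hK.closed.isCompact.image (by fun_prop)).isClosed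
  -- a point of `K` is determined by its `i`-th projection and a bit of a point above it
  have hEunc : ¬ E.Countable := by
    intro hEc
    have hlift : ∀ q : K, ∃ p : X, collapse hS X hD p = q.1 := fun q => by
      have := (hKL q.1 q.2).1
      rw [← hPQ 0] at this
      obtain ⟨p, -, hp⟩ := this
      exact ⟨p, hp⟩
    choose p hp using hlift
    have : Countable E := hEc.to_subtype
    let φ : K → E × Bool := fun q => (⟨(q.1 i).1, q.1, q.2, rfl⟩, ((p q).1 i).bit)
    have hφ : Function.Injective φ := by
      intro q q' h
      have h1 : ((q.1 i).1 : ℝ) = (q'.1 i).1 := congrArg (fun z : E × Bool => (z.1 : ℝ)) h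
      have h2 : ((p q).1 i).bit = ((p q').1 i).bit :=
        congrArg (fun z : E × Bool => z.2) h
      rw [← hp q, ← hp q', collapse_apply_fst, collapse_apply_fst] at h1
      have h3 : collapse hS X hD (p q) i = collapse hS X hD (p q') i :=
        collapse_apply_eq_iff.2 (by simp [SplitInterval.ext' h1 h2])
      rw [hp, hp] at h3
      refine Subtype.ext (funext fun l => ?_)
      by_cases hl : l = i
      · rw [hl, h3]
      · rw [(hKL q.1 q.2).2 l hl, (hKL q'.1 q'.2).2 l hl]
    exact hKunc (countable_coe_iff.1 hφ.countable)
  have hES := not_countable_inter_of_lift hS hX hCantor hE hEunc i hs.1.1 hs.2.1 (by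
    rintro _ ⟨q, hq, rfl⟩
    obtain ⟨p, hp, -⟩ := hfib q hq
    exact ⟨p 0, (p 0).2, hp 0⟩)
  refine fun hc => hES (hc.mono ?_)
  rintro _ ⟨⟨q, hq, rfl⟩, hxS⟩
  obtain ⟨p, hp, hpc, hpb⟩ := hfib q hq
  refine ⟨hxS, fun e => ?_⟩
  obtain ⟨j, hj⟩ := (bool_pairs_of_pairwise_ne _ _ hpb).2.2 e
  exact ⟨p j, (p j).2, (hp j).1, (hp j).2.1, (hp j).2.2, hj⟩

/-! ### Uncountable families of lines -/

lemma exists_fiber_not_countable {α β : Type*} [Countable β] {s : Set α} (hs : ¬ s.Countable)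
    (f : α → β) : ∃ b, ¬ {a ∈ s | f a = b}.Countable := by
  by_contra! h
  exact hs ((countable_iUnion h).mono fun a ha => by
    exact mem_iUnion.2 ⟨f a, ha, rfl⟩)

/-- A set of pairs that escapes every countable set in both coordinates contains an uncountable
set on which both coordinates are injective: a maximal such set cannot be countable. -/
lemma exists_not_countable_injOn {α : Type*} {G : Set (α × α)}
    (h : ∀ D : Set α, D.Countable → ∃ p ∈ G, p.1 ∉ D ∧ p.2 ∉ D) :
    ∃ T ⊆ G, ¬ T.Countable ∧ InjOn Prod.fst T ∧ InjOn Prod.snd T := by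
  obtain ⟨T, hT⟩ := zorn_subset {T : Set (α × α) | T ⊆ G ∧ InjOn Prod.fst T ∧ InjOn Prod.snd T}
    (by
      intro c hc hchain
      refine ⟨⋃₀ c, ⟨sUnion_subset fun T hT => (hc hT).1, ?_, ?_⟩, fun T hT =>
        subset_sUnion_of_mem hT⟩
      all_goals
        rintro p ⟨T₁, hT₁, hp⟩ q ⟨T₂, hT₂, hq⟩ hpq
        rcases hchain.total hT₁ hT₂ with h | h
      · exact (hc hT₂).2.1 (h hp) hq hpq
      · exact (hc hT₁).2.1 hp (h hq) hpq
      · exact (hc hT₂).2.2 (h hp) hq hpq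
      · exact (hc hT₁).2.2 hp (h hq) hpq)
  refine ⟨T, hT.prop.1, fun hc => ?_, hT.prop.2⟩
  obtain ⟨p, hpG, h1, h2⟩ := h (Prod.fst '' T ∪ Prod.snd '' T)
    ((hc.image _).union (hc.image _))
  have hp1 : p.1 ∉ Prod.fst '' T := fun h => h1 (Or.inl h)
  have hp2 : p.2 ∉ Prod.snd '' T := fun h => h2 (Or.inr h)
  have hpT : p ∉ T := fun h => hp1 ⟨p, h, rfl⟩
  refine hpT (hT.le_of_ge ⟨insert_subset hpG hT.prop.1, ?_, ?_⟩ (subset_insert p T)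
    (mem_insert p T))
  · exact (injOn_insert hpT).2 ⟨hT.prop.2.1, hp1⟩
  · exact (injOn_insert hpT).2 ⟨hT.prop.2.2, hp2⟩

/-- If both coordinates are injective on an infinite planar set, then some point of the set lies
strictly between two others, either in an increasing or in a decreasing configuration: all points
but at most four have neighbours in all four half planes. -/
lemma exists_between_of_injOn {T : Set (ℝ × ℝ)} (hT : T.Infinite) (h₁ : InjOn Prod.fst T)
    (h₂ : InjOn Prod.snd T) :
    ∃ a ∈ T, ∃ b ∈ T, ∃ c ∈ T, a.1 < b.1 ∧ c.1 < a.1 ∧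
      (a.2 < b.2 ∧ c.2 < a.2 ∨ b.2 < a.2 ∧ a.2 < c.2) := by
  let M : Bool → Bool → Set (ℝ × ℝ) := fun u v => {a ∈ T | ∀ b ∈ T,
    if u then (if v then b.1 ≤ a.1 else a.1 ≤ b.1) else (if v then b.2 ≤ a.2 else a.2 ≤ b.2)}
  have hM : ∀ u v, (M u v).Finite := fun u v => Set.Subsingleton.finite fun a ha b hb => by
    have hab := ha.2 b hb.1
    have hba := hb.2 a ha.1
    cases u <;> cases v <;> simp only [if_true, if_false, Bool.false_eq_true] at hab hba
    · exact h₂ ha.1 hb.1 (le_antisymm hab hba)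
    · exact h₂ ha.1 hb.1 (le_antisymm hba hab)
    · exact h₁ ha.1 hb.1 (le_antisymm hab hba)
    · exact h₁ ha.1 hb.1 (le_antisymm hba hab)
  obtain ⟨a, haT, ha⟩ := (hT.sdiff (finite_iUnion fun u => finite_iUnion fun v => hM u v)).nonempty
  have hne : ∀ u v, a ∉ M u v := fun u v h => ha (mem_iUnion.2 ⟨u, mem_iUnion.2 ⟨v, h⟩⟩)
  have hR := hne true true
  have hL := hne true false
  have hU := hne false true
  have hD := hne false false
  simp only [M, if_true, if_false, Bool.false_eq_true, mem_ofPred_eq, haT, true_and, not_forall,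
    not_le, exists_prop] at hR hL hU hD
  obtain ⟨b, hb, hab⟩ := hR
  obtain ⟨c, hc, hca⟩ := hL
  obtain ⟨d, hd, had⟩ := hU
  obtain ⟨e, he, hea⟩ := hD
  have n1 : ∀ {x y}, x ∈ T → y ∈ T → x.2 = y.2 → x.1 = y.1 := fun hx hy h => by rw [h₂ hx hy h]
  have n2 : ∀ {x y}, x ∈ T → y ∈ T → x.1 = y.1 → x.2 = y.2 := fun hx hy h => by rw [h₁ hx hy h]
  rcases lt_trichotomy a.2 b.2 with hab2 | hab2 | hab2
  · rcases lt_trichotomy c.2 a.2 with hca2 | hca2 | hca2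
    · exact ⟨a, haT, b, hb, c, hc, hab, hca, Or.inl ⟨hab2, hca2⟩⟩
    · exact absurd (n1 hc haT hca2) hca.ne
    · -- `b` is above and `c` is above: the lower neighbour `e` decides
      rcases lt_trichotomy e.1 a.1 with hea1 | hea1 | hea1
      · exact ⟨a, haT, b, hb, e, he, hab, hea1, Or.inl ⟨hab2, hea⟩⟩
      · exact absurd (n2 he haT hea1) hea.ne
      · exact ⟨a, haT, e, he, c, hc, hea1, hca, Or.inr ⟨hea, hca2⟩⟩
  · exact absurd (n1 haT hb hab2) hab.ne
  · rcases lt_trichotomy c.2 a.2 with hca2 | hca2 | hca2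
    · -- `b` is below and `c` is below: the upper neighbour `d` decides
      rcases lt_trichotomy d.1 a.1 with hda1 | hda1 | hda1
      · exact ⟨a, haT, b, hb, d, hd, hab, hda1, Or.inr ⟨hab2, had⟩⟩
      · exact absurd (n2 hd haT hda1) had.ne'
      · exact ⟨a, haT, d, hd, c, hc, hda1, hca, Or.inl ⟨had, hca2⟩⟩
    · exact absurd (n1 hc haT hca2) hca.ne
    · exact ⟨a, haT, b, hb, c, hc, hab, hca, Or.inr ⟨hab2, hca2⟩⟩

/-- A closed subspace of `I_S³` that is not `3`-dissipated and contains no Cantor set has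
uncountably many full fibers on uncountably many lines parallel to one axis, and no two of these
lines agree in one of their fixed coordinates. -/
lemma exists_not_countable_lines {S : Set ℝ} (hS : S ⊆ Ioo (0 : ℝ) 1)
    {X : Set (Fin 3 → SplitInterval S)} (hX : IsClosed X)
    (hdis : ¬ IsDissipated 3 X) (hCantor : ¬ ContainsCantorSet X) :
    ∃ (i : Fin 3) (T : Set (ℝ × ℝ)), ¬ T.Countable ∧ InjOn Prod.fst T ∧ InjOn Prod.snd T ∧
      ∀ a ∈ T, a.1 ∈ S ∧ a.2 ∈ S ∧ ¬ (fullFibers X i a.1 a.2).Countable := by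
  let G : Fin 3 → Set (ℝ × ℝ) := fun i =>
    {a | a.1 ∈ S ∧ a.2 ∈ S ∧ ¬ (fullFibers X i a.1 a.2).Countable}
  obtain ⟨i, hi⟩ : ∃ i, ∀ D : Set ℝ, D.Countable → ∃ a ∈ G i, a.1 ∉ D ∧ a.2 ∉ D := by
    by_contra! hcon
    choose D hDc hD using hcon
    obtain ⟨D', hD'S, hD'c, hDD', ht⟩ := exists_not_isTightMap_collapse hS hX hdis
      (D₁ := (⋃ i, D i) ∩ S) ((countable_iUnion hDc).mono inter_subset_left) inter_subset_right
    obtain ⟨i, s₁, hs₁, s₂, hs₂, hR⟩ := exists_fullFibers_not_countable hX hCantor hD'c ht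
    exact hs₂.2 (hDD' ⟨mem_iUnion.2 ⟨i, hD i (s₁, s₂) ⟨hs₁.1, hs₂.1, hR⟩ fun h =>
      hs₁.2 (hDD' ⟨mem_iUnion.2 ⟨i, h⟩, hs₁.1⟩)⟩, hs₂.1⟩)
  obtain ⟨T, hTG, hT⟩ := exists_not_countable_injOn hi
  exact ⟨i, T, hT.1, hT.2.1, hT.2.2, fun a ha => hTG ha⟩

/-! ### Interpolation -/

/-- A unital point-separating algebra of functions interpolates arbitrary values on finite sets. -/
lemma Subalgebra.exists_eq_on_finset {X : Type*} [TopologicalSpace X] {A : Subalgebra ℂ C(X, ℂ)}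
    (hA : A.SeparatesPoints) (F : Finset X) (v : X → ℂ) :
    ∃ f : A, ∀ p ∈ F, (f : C(X, ℂ)) p = v p := by
  classical
  have hpair : ∀ p q : X, ∃ g : A, p ≠ q → (g : C(X, ℂ)) p = 1 ∧ (g : C(X, ℂ)) q = 0 := by
    intro p q
    by_cases hpq : p = q
    · exact ⟨0, fun h => absurd hpq h⟩
    · obtain ⟨f, hf, hfp⟩ := hA.strongly (fun x => if x = p then 1 else 0) p q
      exact ⟨⟨f, hf⟩, fun _ => ⟨by simpa using hfp.1, by simpa [Ne.symm hpq] using hfp.2⟩⟩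
  choose g hg using hpair
  refine ⟨∑ p ∈ F, v p • ∏ q ∈ F.erase p, g p q, fun x hx => ?_⟩
  have hval : ((∑ p ∈ F, v p • ∏ q ∈ F.erase p, g p q : A) : C(X, ℂ)) x =
      ∑ p ∈ F, v p * ∏ q ∈ F.erase p, (g p q : C(X, ℂ)) x := by
    simp
  rw [hval, Finset.sum_eq_single x]
  · rw [Finset.prod_eq_one, mul_one]
    intro q hq
    exact (hg x q (Finset.ne_of_mem_erase hq).symm).1
  · intro p hp hpx
    have : ∏ q ∈ F.erase p, (g p q : C(X, ℂ)) x = 0 :=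
      Finset.prod_eq_zero (Finset.mem_erase.2 ⟨hpx.symm, hx⟩) (hg p x hpx).2
    rw [this, mul_zero]
  · exact fun h => absurd hx h

/-- Over every `y ∈ S³`, a point-separating algebra contains a function that on a neighbourhood of
the fiber of `y` is close to prescribed values depending only on the octant at `y`. Compactness
makes this work simultaneously for all octants, also for those whose corner is not in `X`. -/
lemma exists_octant_approx {S : Set ℝ} (hS : S ⊆ Ioo (0 : ℝ) 1)
    {X : Set (Fin 3 → SplitInterval S)} (hX : IsClosed X) {A : Subalgebra ℂ C(X, ℂ)}
    (hA : A.SeparatesPoints) (v : (Fin 3 → Bool) → ℂ) {r : ℝ} (hr : 0 < r) {y : Fin 3 → ℝ}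
    (hy : ∀ i, y i ∈ S) :
    ∃ f : A, ∃ O ∈ TopologicalSpace.countableBasis (Fin 3 → ℝ), y ∈ O ∧
      ∀ p : X, (fun i => (p.1 i).proj) ∈ O →
        ‖(f : C(X, ℂ)) p - v fun i => (p.1 i).side (y i)‖ < r := by
  have : CompactSpace X := isCompact_iff_compactSpace.1 hX.isCompact
  let π : X → Fin 3 → ℝ := fun p i => (p.1 i).proj
  have hπ : Continuous π := continuous_pi fun i =>
    SplitInterval.continuous_proj.comp ((continuous_apply i).comp continuous_subtype_val)
  let σ : X → Fin 3 → Bool := fun p i => (p.1 i).side (y i)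
  have hσ : Continuous σ := continuous_pi fun i =>
    (SplitInterval.continuous_side hS (hy i)).comp
      ((continuous_apply i).comp continuous_subtype_val)
  have hfin : {p | π p = y}.Finite := by
    refine Set.Finite.of_finite_image (f := σ) (toFinite _) fun p hp q hq h => ?_
    refine Subtype.ext (funext fun i => SplitInterval.ext' ?_ ?_)
    · exact (congrFun hp i).trans (congrFun hq i).symm
    · have := congrFun h i
      rwa [show σ p i = (p.1 i).bit from SplitInterval.side_of_eq (congrFun hp i),
        show σ q i = (q.1 i).bit from SplitInterval.side_of_eq (congrFun hq i)] at this
  obtain ⟨f, hf⟩ := Subalgebra.exists_eq_on_finset hA hfin.toFinset fun p => v (σ p)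
  have hbad : IsClosed (π '' {p | r ≤ ‖(f : C(X, ℂ)) p - v (σ p)‖}) := by
    have hc : Continuous fun p => ‖(f : C(X, ℂ)) p - v (σ p)‖ :=
      ((f : C(X, ℂ)).continuous.sub (continuous_of_discreteTopology.comp hσ)).norm
    exact ((isClosed_le continuous_const hc).isCompact.image hπ).isClosed
  have hy' : y ∉ π '' {p | r ≤ ‖(f : C(X, ℂ)) p - v (σ p)‖} := by
    rintro ⟨p, hp, hpy⟩
    have hp : r ≤ ‖(f : C(X, ℂ)) p - v (σ p)‖ := hp
    rw [hf p (hfin.mem_toFinset.2 hpy), sub_self, norm_zero] at hp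
    exact hr.not_ge hp
  obtain ⟨O, hO, hyO, hOsub⟩ :=
    (TopologicalSpace.isBasis_countableBasis (Fin 3 → ℝ)).exists_subset_of_mem_open hy'
      hbad.isOpen_compl
  exact ⟨f, O, hO, hyO, fun p hp => not_le.1 fun h => hOsub hp ⟨p, h, rfl⟩⟩

/-! ### Six separated functions -/

lemma Set.Infinite.exists_lt_lt {s : Set ℝ} (hs : s.Infinite) :
    ∃ x ∈ s, ∃ y ∈ s, ∃ z ∈ s, x < y ∧ y < z := by
  obtain ⟨t, hts, ht⟩ := hs.exists_subset_card_eq 3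
  have hmem : ∀ k, t.orderEmbOfFin ht k ∈ s := fun k => hts (t.orderEmbOfFin_mem ht k)
  exact ⟨_, hmem 0, _, hmem 1, _, hmem 2, (t.orderEmbOfFin ht).strictMono (by decide),
    (t.orderEmbOfFin ht).strictMono (by decide)⟩

lemma exists_separated_values {ι : Type*} [Fintype ι] {δ : ℝ} (hδ : 0 < δ) :
    ∃ v : ι → ℂ, ∀ a b, a ≠ b → δ ≤ ‖v a - v b‖ := by
  let e := Fintype.equivFin ι
  refine ⟨fun a => (δ * ((e a : ℕ) : ℤ) : ℝ), fun a b hab => ?_⟩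
  have h1 : ((e a : ℕ) : ℤ) - ((e b : ℕ) : ℤ) ≠ 0 := fun h =>
    hab (e.injective (Fin.ext (by omega)))
  have h2 : (1 : ℝ) ≤ |((((e a : ℕ) : ℤ) - ((e b : ℕ) : ℤ) : ℤ) : ℝ)| := by
    exact_mod_cast Int.one_le_abs h1
  rw [← Complex.ofReal_sub, Complex.norm_real, ← mul_sub, Real.norm_eq_abs, abs_mul,
    abs_of_pos hδ, ← Int.cast_sub]
  exact le_mul_of_one_le_right hδ.le h2

/-- The point of `ℝ³` with `i`-th coordinate `x` and next coordinates, in cyclic order, `a`. -/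
def linePoint (i : Fin 3) (x : ℝ) (a : ℝ × ℝ) : Fin 3 → ℝ := fun k =>
  if k = i then x else if k = i + 1 then a.1 else a.2

section linePoint

variable (i : Fin 3) (x : ℝ) (a : ℝ × ℝ)

@[simp] lemma linePoint_self : linePoint i x a i = x := by simp [linePoint]

@[simp] lemma linePoint_add_one : linePoint i x a (i + 1) = a.1 := by
  simp [linePoint]

@[simp] lemma linePoint_add_two : linePoint i x a (i + 2) = a.2 := by
  have h1 : i + 2 ≠ i := by omega
  have h2 : i + 2 ≠ i + 1 := by omega
  simp [linePoint, h1, h2]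

lemma forall_fin_three_iff {q : Fin 3 → Prop} : (∀ k, q k) ↔ q i ∧ q (i + 1) ∧ q (i + 2) := by
  refine ⟨fun h => ⟨h _, h _, h _⟩, fun ⟨h0, h1, h2⟩ k => ?_⟩
  obtain rfl | rfl | rfl : k = i ∨ k = i + 1 ∨ k = i + 2 := by omega
  exacts [h0, h1, h2]

end linePoint

theorem mainTheorem9 (S : Set ℝ) (hS : S ⊆ Set.Ioo (0 : ℝ) 1)
    (X : Set (Fin 3 → SplitInterval S)) (hX : IsClosed X)
    (hdis : ¬ IsDissipated 3 X) (hCantor : ¬ ContainsCantorSet X)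
    (r : ℝ) (hr : 0 < r) :
    IsBig r 6 X := by
  refine ⟨isCompact_iff_compactSpace.1 hX.isCompact, fun A hA Υ => ?_⟩
  obtain ⟨i, T, hTunc, hT₁, hT₂, hT⟩ := exists_not_countable_lines hS hX hdis hCantor
  obtain ⟨v, hv⟩ := exists_separated_values (ι := Fin 3 → Bool) (δ := 3 * r) (by positivity)
  let B := TopologicalSpace.countableBasis (Fin 3 → ℝ)
  have hBc : Countable B := (TopologicalSpace.countable_countableBasis _).to_subtype
  have hex : ∀ y : Fin 3 → ℝ, ∃ (f : A) (O : B), (∀ k, y k ∈ S) → y ∈ O.1 ∧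
      ∀ p : X, (fun k => (p.1 k).proj) ∈ O.1 →
        ‖(f : C(X, ℂ)) p - v fun k => (p.1 k).side (y k)‖ < r := by
    intro y
    by_cases hy : ∀ k, y k ∈ S
    · obtain ⟨f, O, hO, h⟩ := exists_octant_approx hS hX hA v hr hy
      exact ⟨f, ⟨O, hO⟩, fun _ => h⟩
    · obtain ⟨O, hO, -⟩ :=
        (TopologicalSpace.isBasis_countableBasis (Fin 3 → ℝ)).exists_subset_of_mem_open
          (mem_univ y) isOpen_univ
      exact ⟨0, ⟨O, hO⟩, fun h => absurd h hy⟩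
  choose f O hfO using hex
  let code : (Fin 3 → ℝ) → ℕ × B := fun y => (Υ (f y), O y)
  -- on each line, three points in full fibers with the same code, separated by rationals
  have hline : ∀ a : ℝ × ℝ, ∃ (n : ℕ × B) (ρ : ℚ × ℚ) (x₁ x₂ c : ℝ), a ∈ T →
      (∀ x ∈ ({x₁, x₂, c} : Set ℝ), x ∈ fullFibers X i a.1 a.2 ∧ code (linePoint i x a) = n) ∧
      x₁ < ρ.1 ∧ ρ.1 < c ∧ c < ρ.2 ∧ ρ.2 < x₂ := by
    intro a
    by_cases ha : a ∈ T
    · obtain ⟨n, hn⟩ := exists_fiber_not_countable (hT a ha).2.2 fun x => code (linePoint i x a)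
      obtain ⟨x₁, h₁, c, hc, x₂, h₂, h1c, hc2⟩ :=
        Set.Infinite.exists_lt_lt fun h => hn h.countable
      obtain ⟨ρ₁, hρ₁⟩ := exists_rat_btwn h1c
      obtain ⟨ρ₂, hρ₂⟩ := exists_rat_btwn hc2
      refine ⟨n, (ρ₁, ρ₂), x₁, x₂, c, fun _ => ⟨?_, hρ₁.1, hρ₁.2, hρ₂.1, hρ₂.2⟩⟩
      rintro x (rfl | rfl | rfl)
      exacts [h₁, h₂, hc]
    · exact ⟨code 0, 0, 0, 0, 0, fun h => absurd h ha⟩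
  choose n ρ x₁ x₂ c hline using hline
  obtain ⟨⟨n₀, ρ₀⟩, hT'⟩ := exists_fiber_not_countable hTunc fun a => (n a, ρ a)
  have hsub : {a ∈ T | (n a, ρ a) = (n₀, ρ₀)} ⊆ T := fun a ha => ha.1
  obtain ⟨a, ha, b, hb, d, hd, hab, hda, hor⟩ := exists_between_of_injOn
    (fun h => hT' h.countable) (hT₁.mono hsub) (hT₂.mono hsub)
  have hn : ∀ t ∈ {a ∈ T | (n a, ρ a) = (n₀, ρ₀)}, n t = n₀ ∧ ρ t = ρ₀ := fun t ht =>
    Prod.ext_iff.1 ht.2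
  -- the point over the line of `a`, in halves opposite to the directions of `b` and `d`
  obtain ⟨e, heb, hed⟩ : ∃ e : Bool, (if e then a.2 < b.2 else b.2 < a.2) ∧
      if e then d.2 < a.2 else a.2 < d.2 := by
    rcases hor with h | h
    · exact ⟨true, by simpa using h⟩
    · exact ⟨false, by simpa using h⟩
  obtain ⟨p, hpX, hp0, hp1, hp2, hpe⟩ := ((hline a ha.1).1 (c a) (by simp)).1.2 e
  let τ : Fin 3 → ℝ × ℝ := ![a, b, d]
  have hτ : ∀ m, τ m ∈ {a ∈ T | (n a, ρ a) = (n₀, ρ₀)} := by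
    intro m
    fin_cases m
    exacts [ha, hb, hd]
  let ξ : Fin 3 × Fin 2 → ℝ := fun m => if m.2 = 0 then x₁ (τ m.1) else x₂ (τ m.1)
  have hξ : ∀ m, ξ m ∈ fullFibers X i (τ m.1).1 (τ m.1).2 ∧
      code (linePoint i (ξ m) (τ m.1)) = n₀ := fun m => by
    rw [← (hn _ (hτ m.1)).1]
    refine (hline _ (hτ m.1).1).1 _ ?_
    by_cases h : m.2 = 0 <;> simp [ξ, h]
  let Y : Fin 3 × Fin 2 → Fin 3 → ℝ := fun m => linePoint i (ξ m) (τ m.1)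
  have hYS : ∀ m k, Y m k ∈ S := fun m => by
    have := hT _ (hτ m.1).1
    rw [forall_fin_three_iff i]
    simpa [Y] using ⟨(hξ m).1.1, this.1, this.2.1⟩
  let σ : Fin 3 × Fin 2 → Fin 3 → Bool := fun m k => (p k).side (Y m k)
  have hσ : Function.Injective σ := by
    have hσ0 : ∀ m, σ m i = decide (m.2 = 0) := fun m => by
      obtain ⟨-, h1, -, -, h2⟩ := hline _ (hτ m.1).1
      obtain ⟨-, -, h3, h4, -⟩ := hline _ ha.1
      rw [(hn _ (hτ m.1)).2] at h1 h2
      rw [(hn _ ha).2] at h3 h4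
      by_cases h : m.2 = 0
      · simp only [σ, Y, ξ, h, if_true, linePoint_self, decide_true]
        exact SplitInterval.side_of_lt (hp0 ▸ h1.trans h3)
      · simp only [σ, Y, ξ, h, if_false, linePoint_self, decide_false]
        exact SplitInterval.side_of_gt (hp0 ▸ h4.trans h2)
    have hσ1 : ∀ m, σ m (i + 1) = ![(p (i + 1)).bit, false, true] m.1 := by
      rintro ⟨m, m'⟩
      simp only [σ, Y, linePoint_add_one]
      fin_cases m
      · exact SplitInterval.side_of_eq hp1
      · exact SplitInterval.side_of_gt (hp1 ▸ hab)
      · exact SplitInterval.side_of_lt (hp1 ▸ hda)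
    have hσ2 : ∀ m, σ m (i + 2) = ![(p (i + 2)).bit, !e, e] m.1 := by
      rintro ⟨m, m'⟩
      simp only [σ, Y, linePoint_add_two]
      fin_cases m
      · exact SplitInterval.side_of_eq hp2
      · cases e
        · exact SplitInterval.side_of_lt (hp2 ▸ heb)
        · exact SplitInterval.side_of_gt (hp2 ▸ heb)
      · cases e
        · exact SplitInterval.side_of_gt (hp2 ▸ hed)
        · exact SplitInterval.side_of_lt (hp2 ▸ hed)
    intro m m' h
    have h0 := congrFun h i
    have h1 := congrFun h (i + 1)
    have h2 := congrFun h (i + 2)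
    rw [hσ0, hσ0] at h0
    rw [hσ1, hσ1] at h1
    rw [hσ2, hσ2] at h2
    have key : ∀ β γ e : Bool, xor β γ = e → ∀ m m' : Fin 3 × Fin 2,
        decide (m.2 = 0) = decide (m'.2 = 0) →
        (![β, false, true] : Fin 3 → Bool) m.1 = ![β, false, true] m'.1 →
        (![γ, !e, e] : Fin 3 → Bool) m.1 = ![γ, !e, e] m'.1 → m = m' := by
      decide
    exact key _ _ _ hpe m m' h0 h1 h2
  have happrox : ∀ m, ‖(f (Y m) : C(X, ℂ)) ⟨p, hpX⟩ - v (σ m)‖ < r := fun m => by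
    refine (hfO (Y m) (hYS m)).2 ⟨p, hpX⟩ ?_
    -- all the codes agree with the code of the point of `ℝ³` below `p`
    have hcode : O (linePoint i (c a) a) = O (Y m) := by
      have h1 := ((hline a ha.1).1 (c a) (by simp)).2
      rw [(hn a ha).1, ← (hξ m).2] at h1
      exact (Prod.ext_iff.1 h1).2
    have hpc : (fun k => (p k).proj) = linePoint i (c a) a := by
      rw [funext_iff, forall_fin_three_iff i]
      simp [hp0, hp1, hp2]
    have hcS : ∀ k, linePoint i (c a) a k ∈ S := by
      rw [forall_fin_three_iff i]
      simpa using ⟨((hline a ha.1).1 (c a) (by simp)).1.1, (hT a ha.1).1, (hT a ha.1).2.1⟩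
    have := (hfO _ hcS).1
    rw [hcode] at this
    rw [hpc]
    exact this
  let ε : Fin 6 ≃ Fin 3 × Fin 2 := (finProdFinEquiv (m := 3) (n := 2)).symm
  refine ⟨fun u => f (Y (ε u)), ⟨p, hpX⟩, fun u w => ?_, fun u w huw => ?_⟩
  · exact (Prod.ext_iff.1 ((hξ (ε u)).2.trans (hξ (ε w)).2.symm)).1
  · have h1 := hv (σ (ε u)) (σ (ε w)) fun h => huw.ne (ε.injective (hσ h))
    have h2 := happrox (ε u)
    have h3 := happrox (ε w)
    have h4 := norm_sub_le_norm_sub_add_norm_sub (v (σ (ε u)))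
      ((f (Y (ε u)) : C(X, ℂ)) ⟨p, hpX⟩) (v (σ (ε w)))
    have h5 := norm_sub_le_norm_sub_add_norm_sub ((f (Y (ε u)) : C(X, ℂ)) ⟨p, hpX⟩)
      ((f (Y (ε w)) : C(X, ℂ)) ⟨p, hpX⟩) (v (σ (ε w)))
    rw [norm_sub_rev] at h2
    linarith
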